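/- Let $M$ be a compact Hausdorff smooth manifold of finite dimension with (possibly empty) boundary $\partial M$, corners being allowed, and let $W \subseteq \partial M$ be a closed subset; the main case is $W = \partial M$. A collar of $W$ is a neighbourhood $C$ of $W$ in $M$ together with a diffeomorphism $\Phi : W \times [0,1] \to C$ such that $\Phi(x,1) = x$ for all $x \in W$. (A map defined on a subset of a manifold is smooth if near each point of the subset it is the restriction of smooth maps; $W\times[0,1]$ is regarded as a subset of $M \times \mathbb{R}$, and $C$ as a subset of $M$.) Suppose that $W$ has a collar $C_0$ each of whose connected components is contractible. Let $P$ be a finite-dimensional complex vector space and let $\pi : E \to M$ be a smooth complex vector bundle with typical fibre $P$. Then there exist a smooth complex vector bundle $\widehat{\pi} : \widehat{E} \to M$ with typical fibre $P$ and a collar $C \subseteq C_0$ of $W$ such that the restriction $\widehat{E}|_{C}$ is isomorphic, as a smooth complex vector bundle, to the trivial bundle $C \times P$, and the restriction $\widehat{E}|_{M \setminus C_0}$ is isomorphic, as a smooth complex vector bundle, to $E|_{M \setminus C_0}$. -/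

import Mathlib

open scoped Manifold ContDiff Topology
open Bundle

universe u v w z t t'

noncomputable section

/-- Restriction of scalars: the trivializations of a complex vector bundle also make it a
real vector bundle (of twice the rank). -/
instance VectorBundle.complexToReal {M : Type*} [TopologicalSpace M]
    {P : Type*} [NormedAddCommGroup P] [NormedSpace ℂ P]
    {E : M → Type*} [∀ x, AddCommGroup (E x)] [∀ x, Module ℂ (E x)]
    [TopologicalSpace (TotalSpace P E)] [∀ x, TopologicalSpace (E x)]
    [FiberBundle P E] [VectorBundle ℂ P E] : VectorBundle ℝ P E := by
  have hlin : ∀ (e : Trivialization P (π P E)) [MemTrivializationAtlas e], e.IsLinear ℝ := by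
    intro e he
    refine ⟨fun b hb => ?_⟩
    have h := Trivialization.linear ℂ e hb
    refine ⟨h.map_add, fun c x => ?_⟩
    have := h.map_smul (c : ℂ) x
    simpa using this
  refine ⟨hlin, fun e e' he he' => ?_⟩
  have := hlin e
  have := hlin e'
  have h := continuousOn_coordChange ℂ e e'
  have hc : Continuous (ContinuousLinearMap.restrictScalarsL ℂ P P ℝ ℝ) :=
    (ContinuousLinearMap.restrictScalarsL ℂ P P ℝ ℝ).continuous
  refine (hc.comp_continuousOn h).congr fun b hb => ?_
  ext v
  simp [Trivialization.coordChangeL_apply _ _ hb]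

/-- A smooth complex vector bundle with typical fibre `P` over a (real) manifold `M`:
the fibres are complex vector spaces, the local trivializations are complex linear, and the
transition functions are smooth over `ℝ`. -/
structure SmoothComplexBundle {EM : Type u} [NormedAddCommGroup EM]
    [NormedSpace ℝ EM] {H : Type v} [TopologicalSpace H] (I : ModelWithCorners ℝ EM H)
    (M : Type w) [TopologicalSpace M] [ChartedSpace H M]
    (P : Type z) [NormedAddCommGroup P] [NormedSpace ℂ P] where
  /-- the fibre over a point -/
  Fib : M → Type t
  [addCommGroup : ∀ x, AddCommGroup (Fib x)]
  [module : ∀ x, Module ℂ (Fib x)]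
  [topFib : ∀ x, TopologicalSpace (Fib x)]
  [topTotal : TopologicalSpace (TotalSpace P Fib)]
  [fiberBundle : FiberBundle P Fib]
  [vectorBundle : VectorBundle ℂ P Fib]
  [smooth : ContMDiffVectorBundle ∞ P Fib I]

namespace SmoothComplexBundle

attribute [instance] addCommGroup module topFib topTotal fiberBundle vectorBundle smooth

variable {EM : Type*} [NormedAddCommGroup EM] [NormedSpace ℝ EM]
  {H : Type*} [TopologicalSpace H] {I : ModelWithCorners ℝ EM H}
  {M : Type*} [TopologicalSpace M] [ChartedSpace H M]
  {P : Type*} [NormedAddCommGroup P] [NormedSpace ℂ P]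

/-- The total space. -/
abbrev Total (E : SmoothComplexBundle I M P) : Type _ := TotalSpace P E.Fib

variable (I M P) in
/-- The product bundle `M × P → M`. -/
def trivial : SmoothComplexBundle I M P where
  Fib := Bundle.Trivial M P
  addCommGroup := fun _ => inferInstanceAs (AddCommGroup P)
  module := fun _ => inferInstanceAs (Module ℂ P)

/-- The restrictions `E|_S` and `F|_S` are isomorphic as smooth complex vector bundles: there
are complex linear isomorphisms `E_x ≃ F_x` which over `S` depend smoothly on `x`, in both
directions. (The isomorphisms at points outside `S` carry no information, since all fibres
are isomorphic to `P`.) -/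
def IsoOn (S : Set M) (E : SmoothComplexBundle.{_, _, _, _, t} I M P)
    (F : SmoothComplexBundle.{_, _, _, _, t'} I M P) : Prop :=
  ∃ φ : ∀ x, E.Fib x ≃ₗ[ℂ] F.Fib x,
    ContMDiffOn (I.prod 𝓘(ℝ, P)) (I.prod 𝓘(ℝ, P)) ∞
      (fun v : E.Total => (⟨v.proj, φ v.proj v.2⟩ : F.Total)) {v | v.proj ∈ S} ∧
    ContMDiffOn (I.prod 𝓘(ℝ, P)) (I.prod 𝓘(ℝ, P)) ∞
      (fun v : F.Total => (⟨v.proj, (φ v.proj).symm v.2⟩ : E.Total)) {v | v.proj ∈ S}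

/-- The restriction of `E` to `S` is (isomorphic to) the trivial bundle `S × P`. -/
def TrivialOn (S : Set M) (E : SmoothComplexBundle I M P) : Prop :=
  IsoOn S E (trivial I M P)

end SmoothComplexBundle

/-- `C` is a collar of the part `W` of the boundary of `M`: a neighbourhood of `W` that is
diffeomorphic to `W × [0, 1]` by a diffeomorphism `Φ : W × [0, 1] → C` that restricts to the
identification of `W × {1}` with `W`. Here `W × [0, 1]` and `C` are subsets of the
manifolds `M × ℝ` and `M`, and a map defined on a subset of a manifold is smooth if near each
point of the subset it is the restriction of smooth maps. -/
def IsCollar {EM : Type*} [NormedAddCommGroup EM] [NormedSpace ℝ EM]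
    {H : Type*} [TopologicalSpace H] (I : ModelWithCorners ℝ EM H)
    {M : Type*} [TopologicalSpace M] [ChartedSpace H M] (W C : Set M) : Prop :=
  C ∈ 𝓝ˢ W ∧
  ∃ Φ : PartialEquiv (M × ℝ) M,
    Φ.source = W ×ˢ Set.Icc (0 : ℝ) 1 ∧ Φ.target = C ∧
    (∀ x ∈ W, Φ (x, 1) = x) ∧
    ContMDiffOn (I.prod 𝓘(ℝ, ℝ)) I ∞ Φ Φ.source ∧
    ContMDiffOn I (I.prod 𝓘(ℝ, ℝ)) ∞ Φ.symm Φ.target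

end

/-! No modification is needed: `E` itself is already trivial over `C₀`. The collar is the image of
the compact set `W × [0, 1]`, so it is closed, and everything rests on
`trivialOn_of_contractibleSpace`. Write `E` as a summand of a trivial bundle, that is, as the image
of an idempotent-valued function `p` on `M`. On a contractible closed set `D`, a contraction gives a
path from `p` to a constant in the Banach algebra of continuous functions on `D`. Close idempotents
are related by a unit, so a continuous invertible `g` carries the image of `p x` into that of `p c`.
A smooth approximation of `g` still gives injective maps to one fibre, hence a smooth trivialization
over `D`. Injectivity is an open condition, so each component's trivialization persists on a clopen
neighbourhood in `C₀`. By compactness finitely many of these suffice, and they are glued. -/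

/-! ### Idempotents in Banach algebras. -/

/-- A path of idempotents in a complete normed ring is carried along by a unit. -/
theorem exists_unit_mul_mul_of_idempotent_path {A T : Type*} [NormedRing A] [CompleteSpace A]
    [TopologicalSpace T] [PreconnectedSpace T] {q : T → A} (hq : Continuous q)
    (hid : ∀ r, q r * q r = q r) (r s : T) :
    ∃ u : Aˣ, q s * (u * q r) = u * q r := by
  refine PreconnectedSpace.induction₂' (fun r s => ∃ u : Aˣ, q s * (u * q r) = u * q r)
    (fun r => ?_) ⟨?_⟩ r s
  · have key : ∀ a b : A, a * a = a → b * b = b → ‖a - b‖ < 1 →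
        ∃ u : Aˣ, b * (u * a) = u * a := by
      intro a b ha hb hab
      -- `1 - (a - b)` is a unit by the Neumann series, and `(1 - (a - b)) * a = b * a`, which left
      -- multiplication by `b` fixes.
      refine ⟨Units.oneSub (a - b) hab, ?_⟩
      have h : (1 - (a - b)) * a = b * a := by
        rw [sub_mul, sub_mul, one_mul, ha]; abel
      rw [Units.val_oneSub, h, ← mul_assoc, hb]
    have h1 : ∀ᶠ s in 𝓝 r, dist (q s) (q r) < 1 :=
      hq.continuousAt.eventually (Metric.ball_mem_nhds (q r) one_pos)
    filter_upwards [h1] with s hs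
    refine ⟨key _ _ (hid r) (hid s) ?_, key _ _ (hid s) (hid r) ?_⟩
    · rwa [← dist_eq_norm, dist_comm]
    · rwa [← dist_eq_norm]
  · rintro a b c ⟨u, hu⟩ ⟨w, hw⟩
    refine ⟨w * u, ?_⟩
    calc q c * (↑(w * u) * q a) = q c * (w * (u * q a)) := by rw [Units.val_mul, mul_assoc]
      _ = q c * (w * q b) * (u * q a) := by
          rw [mul_assoc (q c), mul_assoc (w : A), hu]
      _ = w * (q b * (u * q a)) := by rw [hw, mul_assoc]
      _ = ↑(w * u) * q a := by rw [hu, Units.val_mul, mul_assoc]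

/-- An idempotent-valued function on a compact contractible space can be carried into a
constant one by a continuous function with values in the units. -/
theorem ContractibleSpace.exists_unit_mul_mul_of_idempotent {A D : Type*} [NormedRing A]
    [CompleteSpace A] [TopologicalSpace D] [CompactSpace D] [ContractibleSpace D]
    (p : C(D, A)) (hp : ∀ x, p x * p x = p x) :
    ∃ (c : D) (g g' : C(D, A)), (∀ x, g' x * g x = 1) ∧
      ∀ x, p c * (g x * p x) = g x * p x := by
  obtain ⟨c, ⟨h⟩⟩ := id_nullhomotopic D
  -- The path runs from `p` at `0` to the constant `p c` at `1`; compactness of `D` makes `C(D, A)`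
  -- a complete normed ring.
  let q : C(unitInterval, C(D, A)) := (p.comp h.toContinuousMap).curry
  obtain ⟨u, hu⟩ := exists_unit_mul_mul_of_idempotent_path (q := q) q.continuous
    (fun r => by ext x; exact hp _) 0 1
  refine ⟨c, u, (u⁻¹ : (C(D, A))ˣ), fun x => ?_, fun x => ?_⟩
  · exact congrArg (fun f : C(D, A) => f x) u.inv_mul
  · have hx := congrArg (fun f : C(D, A) => f x) hu
    simpa [q] using hx

/-! ### Smooth families of fibrewise linear maps. -/

namespace SmoothComplexBundle

section

variable {EM : Type*} [NormedAddCommGroup EM] [NormedSpace ℝ EM]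
  {H : Type*} [TopologicalSpace H] {I : ModelWithCorners ℝ EM H}
  {M : Type*} [TopologicalSpace M] [ChartedSpace H M]
  {P : Type*} [NormedAddCommGroup P] [NormedSpace ℂ P]
  {F : Type*} [NormedAddCommGroup F] [NormedSpace ℂ F]
  {F' : Type*} [NormedAddCommGroup F'] [NormedSpace ℂ F']
  {E : SmoothComplexBundle I M P}

/-- The preferred trivialization of `E` at a point. -/
abbrev triv (E : SmoothComplexBundle I M P) (x₀ : M) : Trivialization P (π P E.Fib) :=
  trivializationAt P E.Fib x₀

/-- A family of linear maps from the fibres of `E` to a fixed space is smooth if it is smooth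
in the preferred trivialization at each point. -/
def SmoothHom (ψ : ∀ x, E.Fib x →L[ℂ] F) : Prop :=
  ∀ x₀, ContMDiffAt I 𝓘(ℝ, P →L[ℝ] F) ∞
    (fun x => ((ψ x).comp ((E.triv x₀).symmL ℂ x)).restrictScalars ℝ) x₀

theorem SmoothHom.add {ψ ψ' : ∀ x, E.Fib x →L[ℂ] F} (h : SmoothHom ψ) (h' : SmoothHom ψ') :
    SmoothHom (fun x => ψ x + ψ' x) := fun x₀ => (h x₀).add (h' x₀)

theorem SmoothHom.smul {ψ : ∀ x, E.Fib x →L[ℂ] F} (h : SmoothHom ψ) {χ : M → ℝ}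
    (hχ : ContMDiff I 𝓘(ℝ) ∞ χ) : SmoothHom (fun x => χ x • ψ x) :=
  fun x₀ => (hχ x₀).smul (h x₀)

theorem SmoothHom.clm_comp {ψ : ∀ x, E.Fib x →L[ℂ] F} (h : SmoothHom ψ) {G : M → F →L[ℂ] F'}
    (hG : ContMDiff I 𝓘(ℝ, F →L[ℂ] F') ∞ G) : SmoothHom (fun x => (G x).comp (ψ x)) := by
  intro x₀
  have hG' : ContMDiffAt I 𝓘(ℝ, F →L[ℝ] F') ∞ (fun x => (G x).restrictScalars ℝ) x₀ :=
    ((ContinuousLinearMap.restrictScalarsL ℂ F F' ℝ ℝ).contDiff.contMDiff.comp hG) x₀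
  exact hG'.clm_comp (h x₀)

theorem SmoothHom.pi {ι : Type*} [Fintype ι] {ψ : ι → ∀ x, E.Fib x →L[ℂ] F}
    (h : ∀ i, SmoothHom (ψ i)) :
    SmoothHom (fun x => ContinuousLinearMap.pi (fun i => ψ i x)) := by
  classical
  intro x₀
  have h1 : ∀ i, ContMDiffAt I 𝓘(ℝ, P →L[ℝ] (ι → F)) ∞ (fun x =>
      (ContinuousLinearMap.single ℝ (fun _ : ι => F) i).comp
        (((ψ i x).comp ((E.triv x₀).symmL ℂ x)).restrictScalars ℝ)) x₀ :=
    fun i => contMDiffAt_const.clm_comp (h i x₀)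
  have h2 := contMDiffAt_finsetSum (t := Finset.univ) (fun i _ => h1 i)
  refine h2.congr_of_eventuallyEq (.of_forall fun x => ?_)
  ext v j
  simp [Finset.sum_apply, Pi.single_apply]

/-- The local representatives of a smooth family act on the coordinates of vectors. -/
theorem comp_symmL_apply_triv (ψ : ∀ x, E.Fib x →L[ℂ] F) {x₀ x : M}
    (hx : x ∈ (E.triv x₀).baseSet) (w : E.Fib x) :
    ((ψ x).comp ((E.triv x₀).symmL ℂ x)) ((E.triv x₀) ⟨x, w⟩).2 = ψ x w := by
  rw [← Trivialization.continuousLinearMapAt_apply_of_mem (R := ℂ) _ hx,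
    ContinuousLinearMap.comp_apply, Trivialization.symmL_continuousLinearMapAt _ hx]

theorem injective_of_injective_comp_symmL {ψ : ∀ x, E.Fib x →L[ℂ] F} {x₀ x : M}
    (hx : x ∈ (E.triv x₀).baseSet)
    (h : Function.Injective ((ψ x).comp ((E.triv x₀).symmL ℂ x))) :
    Function.Injective (ψ x) := by
  intro w w' hw
  rw [← comp_symmL_apply_triv ψ hx, ← comp_symmL_apply_triv ψ hx w'] at hw
  have h2 := h hw
  rw [← Trivialization.continuousLinearMapAt_apply_of_mem (R := ℂ) _ hx,
    ← Trivialization.continuousLinearMapAt_apply_of_mem (R := ℂ) _ hx] at h2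
  rw [← Trivialization.symmL_continuousLinearMapAt (R := ℂ) _ hx w, h2,
    Trivialization.symmL_continuousLinearMapAt _ hx]

theorem injective_comp_symmL {ψ : ∀ x, E.Fib x →L[ℂ] F} {x₀ x : M}
    (hx : x ∈ (E.triv x₀).baseSet) (h : Function.Injective (ψ x)) :
    Function.Injective ((ψ x).comp ((E.triv x₀).symmL ℂ x)) := by
  rw [ContinuousLinearMap.coe_comp]
  refine h.comp (Function.LeftInverse.injective (g := (E.triv x₀).continuousLinearMapAt ℂ x) ?_)
  exact Trivialization.continuousLinearMapAt_symmL _ hx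

/-- An injective endomorphism of the typical fibre is a real continuous linear equivalence. -/
theorem exists_continuousLinearEquiv_of_injective [FiniteDimensional ℂ P] {T : P →L[ℂ] P}
    (hT : Function.Injective T) : ∃ e : P ≃L[ℝ] P, (e : P →L[ℝ] P) = T.restrictScalars ℝ :=
  ⟨(LinearEquiv.ofInjectiveEndo (T.restrictScalars ℝ).toLinearMap hT).toContinuousLinearEquiv,
    by ext; rfl⟩

theorem eventually_mem_baseSet (E : SmoothComplexBundle I M P) (x₀ : M) :
    ∀ᶠ x in 𝓝 x₀, x ∈ (E.triv x₀).baseSet :=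
  (E.triv x₀).open_baseSet.mem_nhds (mem_baseSet_trivializationAt P E.Fib x₀)

/-- A smooth family of linear maps to the typical fibre, bijective over `S`, trivializes the
bundle over `S`. -/
theorem SmoothHom.trivialOn [FiniteDimensional ℂ P] {ψ : ∀ x, E.Fib x →L[ℂ] P}
    (hψ : SmoothHom ψ) {S : Set M} (hS : ∀ x ∈ S, Function.Injective (ψ x)) : E.TrivialOn S := by
  classical
  let e₀ : ∀ x, E.Fib x ≃ₗ[ℂ] P := fun x =>
    ((E.triv x).continuousLinearEquivAt ℂ x (mem_baseSet_trivializationAt P E.Fib x)).toLinearEquiv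
  have hfd : ∀ x, FiniteDimensional ℂ (E.Fib x) := fun x => (e₀ x).symm.finiteDimensional
  let φ : ∀ x, E.Fib x ≃ₗ[ℂ] P := fun x =>
    if h : x ∈ S then LinearMap.linearEquivOfInjective (ψ x).toLinearMap (hS x h)
      (e₀ x).finrank_eq else e₀ x
  have hφ : ∀ x ∈ S, ∀ w, φ x w = ψ x w := fun x hx w => by simp [φ, hx]
  refine ⟨φ, ?_, ?_⟩
  · intro v hv
    rw [contMDiffWithinAt_totalSpace]
    refine ⟨contMDiffWithinAt_proj _, ?_⟩
    have h1 : ContMDiffAt (I.prod 𝓘(ℝ, P)) 𝓘(ℝ, P →L[ℝ] P) ∞ (fun w : E.Total =>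
        ((ψ w.proj).comp ((E.triv v.proj).symmL ℂ w.proj)).restrictScalars ℝ) v :=
      (hψ v.proj).comp v (contMDiffAt_proj _)
    have h2 : ContMDiffAt (I.prod 𝓘(ℝ, P)) 𝓘(ℝ, P) ∞
        (fun w : E.Total => ((E.triv v.proj) w).2) v :=
      ((contMDiffAt_totalSpace (f := fun w : E.Total => w)).1 contMDiffAt_id).2
    have h3 := (h1.clm_apply h2).contMDiffWithinAt (s := {v : E.Total | v.proj ∈ S})
    refine h3.congr_of_eventuallyEq_of_mem ?_ hv
    have h4 : ∀ᶠ w : E.Total in 𝓝 v, w.proj ∈ (E.triv v.proj).baseSet :=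
      (contMDiff_proj (n := ∞) (IB := I) E.Fib).continuous.continuousAt.eventually
        (eventually_mem_baseSet E v.proj)
    filter_upwards [nhdsWithin_le_nhds h4, self_mem_nhdsWithin] with w hw hwS
    exact (hφ _ hwS _).trans (comp_symmL_apply_triv ψ hw w.2).symm
  · intro v hv
    rw [contMDiffWithinAt_totalSpace]
    refine ⟨contMDiffWithinAt_proj _, ?_⟩
    have := FiniteDimensional.complete ℂ P
    obtain ⟨e, he⟩ := exists_continuousLinearEquiv_of_injective
      (injective_comp_symmL (mem_baseSet_trivializationAt P E.Fib v.proj) (hS _ hv))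
    have h1 : ContMDiffAt (I.prod 𝓘(ℝ, P)) 𝓘(ℝ, P →L[ℝ] P) ∞
        (fun w : (trivial I M P).Total =>
          ((ψ w.proj).comp ((E.triv v.proj).symmL ℂ w.proj)).restrictScalars ℝ) v :=
      (hψ v.proj).comp v (contMDiffAt_proj _)
    -- The inverse family is smooth because operator inversion is smooth at every invertible
    -- operator.
    have hinv : ContMDiffAt 𝓘(ℝ, P →L[ℝ] P) 𝓘(ℝ, P →L[ℝ] P) ∞ ContinuousLinearMap.inverse
        (((ψ v.proj).comp ((E.triv v.proj).symmL ℂ v.proj)).restrictScalars ℝ) := by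
      rw [← he]
      exact (contDiffAt_map_inverse e).contMDiffAt
    have h2 : ContMDiffAt (I.prod 𝓘(ℝ, P)) 𝓘(ℝ, P) ∞
        (fun w : (trivial I M P).Total => w.2) v :=
      ((contMDiffAt_totalSpace (f := fun w : (trivial I M P).Total => w)).1 contMDiffAt_id).2
    have h3 := ((hinv.comp v h1).clm_apply h2).contMDiffWithinAt
      (s := {v : (trivial I M P).Total | v.proj ∈ S})
    refine h3.congr_of_eventuallyEq_of_mem ?_ hv
    have h4 : ∀ᶠ w : (trivial I M P).Total in 𝓝 v, w.proj ∈ (E.triv v.proj).baseSet :=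
      (contMDiff_proj (n := ∞) (IB := I) (trivial I M P).Fib).continuous.continuousAt.eventually
        (eventually_mem_baseSet E v.proj)
    filter_upwards [nhdsWithin_le_nhds h4, self_mem_nhdsWithin] with w hw hwS
    obtain ⟨e', he'⟩ := exists_continuousLinearEquiv_of_injective
      (injective_comp_symmL hw (hS _ hwS))
    have h5 : ((ψ w.proj).comp ((E.triv v.proj).symmL ℂ w.proj))
        ((E.triv v.proj) ⟨w.proj, (φ w.proj).symm w.2⟩).2 = w.2 := by
      rw [comp_symmL_apply_triv ψ hw, ← hφ _ hwS]
      exact (φ w.proj).apply_symm_apply w.2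
    simp only [Function.comp_apply, ← he', ContinuousLinearMap.inverse_equiv]
    refine (e'.symm_apply_eq.2 ?_).symm
    refine h5.symm.trans ?_
    exact (congrArg (fun T : P →L[ℝ] P =>
      T ((E.triv v.proj) ⟨w.proj, (φ w.proj).symm w.2⟩).2) he').symm

/-- Injectivity of a smooth family of linear maps to the typical fibre is an open condition. -/
theorem SmoothHom.eventually_injective [FiniteDimensional ℂ P] {ψ : ∀ x, E.Fib x →L[ℂ] P}
    (hψ : SmoothHom ψ) {x₀ : M} (h : Function.Injective (ψ x₀)) :
    ∀ᶠ x in 𝓝 x₀, Function.Injective (ψ x) := by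
  have := FiniteDimensional.complete ℂ P
  obtain ⟨e, he⟩ := exists_continuousLinearEquiv_of_injective
    (injective_comp_symmL (mem_baseSet_trivializationAt P E.Fib x₀) h)
  have h1 := (hψ x₀).continuousAt.eventually (he ▸ e.nhds)
  filter_upwards [h1, eventually_mem_baseSet E x₀] with x ⟨e', he'⟩ hx
  refine injective_of_injective_comp_symmL hx fun w w' hw => e'.injective ?_
  have h2 := fun w => congrArg (fun T : P →L[ℝ] P => T w) he'
  exact (h2 w).trans (Eq.trans hw (h2 w').symm)

end
end SmoothComplexBundle

/-! ### Embedding into a trivial bundle. -/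

namespace SmoothComplexBundle

section

variable {EM : Type*} [NormedAddCommGroup EM] [NormedSpace ℝ EM]
  {H : Type*} [TopologicalSpace H] {I : ModelWithCorners ℝ EM H}
  {M : Type*} [TopologicalSpace M] [ChartedSpace H M]
  {P : Type*} [NormedAddCommGroup P] [NormedSpace ℂ P]
  {E : SmoothComplexBundle I M P}

/-- A coordinate change, multiplied by a smooth function supported where it is defined. -/
theorem contMDiffAt_smul_coordChange {e e' : Trivialization P (π P E.Fib)}
    [MemTrivializationAtlas e] [MemTrivializationAtlas e'] {χ : M → ℝ}
    (hχ : ContMDiff I 𝓘(ℝ) ∞ χ) {x₀ : M}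
    (hx₀ : x₀ ∈ tsupport χ → x₀ ∈ e.baseSet ∧ x₀ ∈ e'.baseSet) :
    ContMDiffAt I 𝓘(ℝ, P →L[ℝ] P) ∞ (fun x => χ x •
      ((e'.continuousLinearMapAt ℂ x).comp (e.symmL ℂ x)).restrictScalars ℝ) x₀ := by
  by_cases h : x₀ ∈ tsupport χ
  · obtain ⟨h1, h2⟩ := hx₀ h
    refine ((hχ x₀).smul (contMDiffAt_coordChangeL (𝕜 := ℝ) h1 h2)).congr_of_eventuallyEq ?_
    filter_upwards [e.open_baseSet.mem_nhds h1, e'.open_baseSet.mem_nhds h2] with x h3 h4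
    congr 1
    ext v
    change e'.continuousLinearMapAt ℂ x (e.symmL ℂ x v) = Trivialization.coordChangeL ℝ e e' x v
    rw [Trivialization.coordChangeL_apply _ _ ⟨h3, h4⟩,
      Trivialization.continuousLinearMapAt_apply_of_mem (R := ℂ) _ h4,
      Trivialization.symmL_apply _ h3]
  · refine (contMDiffAt_const (c := 0)).congr_of_eventuallyEq ?_
    filter_upwards [notMem_tsupport_iff_eventuallyEq.1 h] with x hx
    rw [hx, Pi.zero_apply, zero_smul]

/-- A smooth complex vector bundle over a compact manifold is a direct summand of a trivial
bundle. -/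
theorem exists_summand_of_trivial [FiniteDimensional ℝ EM] [IsManifold I ∞ M] [T2Space M]
    [CompactSpace M] (E : SmoothComplexBundle I M P) :
    ∃ (s : Finset M) (a : ∀ x, E.Fib x →L[ℂ] (s → P)) (b : ∀ x, (s → P) →L[ℂ] E.Fib x),
      SmoothHom a ∧ (∀ x w, b x (a x w) = w) ∧ Continuous fun x => (a x).comp (b x) := by
  classical
  obtain ⟨f, hf⟩ := SmoothPartitionOfUnity.exists_isSubordinate I isClosed_univ
    (fun i => (E.triv i).baseSet) (fun i => (E.triv i).open_baseSet)
    (fun x _ => Set.mem_iUnion.2 ⟨x, mem_baseSet_trivializationAt P E.Fib x⟩)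
  have hfin := f.locallyFinite.finite_nonempty_of_compact
  let s : Finset M := hfin.toFinset
  have hs : ∀ i x, f i x ≠ 0 → i ∈ s := fun i x h => hfin.mem_toFinset.2 ⟨x, h⟩
  have hcm : ∀ i, ContMDiff I 𝓘(ℝ) ∞ (f i) := fun i => (f i).contMDiff
  -- Both `a` and `b` carry the weight `f i`, so `b ∘ a` produces squares; dividing by `σ` makes it
  -- the identity.
  let σ : M → ℝ := fun x => ∑ i : s, f i x * f i x
  have hσ : ∀ x, σ x ≠ 0 := by
    intro x
    obtain ⟨i, hi⟩ := f.exists_pos_of_mem (Set.mem_univ x)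
    have hpos : 0 < σ x := Finset.sum_pos' (fun j _ => mul_self_nonneg _)
      ⟨⟨i, hs i x hi.ne'⟩, Finset.mem_univ _, mul_pos hi hi⟩
    exact hpos.ne'
  have hσc : Continuous σ :=
    continuous_finsetSum _ fun i _ => (hcm i).continuous.mul (hcm i).continuous
  have hmem : ∀ i x, f i x ≠ 0 → x ∈ (E.triv i).baseSet := fun i x h =>
    hf i (subset_tsupport _ h)
  let a : ∀ x, E.Fib x →L[ℂ] (s → P) := fun x => ContinuousLinearMap.pi fun i : s =>
    f i x • (E.triv (i : M)).continuousLinearMapAt ℂ x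
  -- The sum is formed in `P` and then moved to the fibre, whose topology is not assumed compatible
  -- with addition.
  let b : ∀ x, (s → P) →L[ℂ] E.Fib x := fun x => ((E.triv x).symmL ℂ x).comp
    (∑ i : s, (σ x)⁻¹ • f i x • (((E.triv x).continuousLinearMapAt ℂ x).comp
      ((E.triv (i : M)).symmL ℂ x)).comp (ContinuousLinearMap.proj i))
  have hb : ∀ x w, b x w = ∑ i : s, (σ x)⁻¹ • f i x • (E.triv (i : M)).symmL ℂ x (w i) := by
    intro x w
    simp only [b, ContinuousLinearMap.comp_apply, sum_apply, map_sum]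
    refine Finset.sum_congr rfl fun i _ => ?_
    simp only [smul_apply, ContinuousLinearMap.comp_apply,
      ContinuousLinearMap.proj_apply, ContinuousLinearMap.map_smul_of_tower]
    rw [Trivialization.symmL_continuousLinearMapAt _ (mem_baseSet_trivializationAt P E.Fib x)]
  have ha : SmoothHom a := by
    refine SmoothHom.pi fun i x₀ => ?_
    exact contMDiffAt_smul_coordChange (hcm i) fun h =>
      ⟨mem_baseSet_trivializationAt P E.Fib x₀, hf i h⟩
  refine ⟨s, a, b, ha, fun x w => ?_, ?_⟩
  · have h1 : ∀ i : s, f i x • (E.triv (i : M)).symmL ℂ x (a x w i) = (f i x * f i x) • w := by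
      intro i
      by_cases h : f i x = 0
      · simp [h]
      · change f i x • (E.triv (i : M)).symmL ℂ x
          (f i x • (E.triv (i : M)).continuousLinearMapAt ℂ x w) = _
        rw [ContinuousLinearMap.map_smul_of_tower,
          Trivialization.symmL_continuousLinearMapAt _ (hmem _ _ h), smul_smul]
    rw [hb, Finset.sum_congr rfl fun i _ => congrArg _ (h1 i), ← Finset.smul_sum,
      ← Finset.sum_smul, smul_smul, inv_mul_cancel₀ (hσ x), one_smul]
  · refine (ContinuousLinearMap.isEmbedding_restrictScalars ℝ).continuous_iff.2 ?_
    refine continuous_iff_continuousAt.2 fun x₀ => ?_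
    -- Near `x₀`, passing through the trivialization there factors `a ∘ b` into two continuous
    -- families of operators between fixed spaces.
    have h1 : ∀ i : s, ContinuousAt (fun x => (σ x)⁻¹ •
        (f i x • (((E.triv x₀).continuousLinearMapAt ℂ x).comp
          ((E.triv (i : M)).symmL ℂ x)).restrictScalars ℝ).comp
            (ContinuousLinearMap.proj (R := ℝ) (φ := fun _ : s => P) i)) x₀ := fun i =>
      (hσc.continuousAt.inv₀ (hσ x₀)).smul
        ((contMDiffAt_smul_coordChange (hcm i) fun h =>
          ⟨hf i h, mem_baseSet_trivializationAt P E.Fib x₀⟩).continuousAt.clm_comp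
          continuousAt_const)
    have h2 := (ha x₀).continuousAt.clm_comp
      (tendsto_finsetSum Finset.univ fun i _ => h1 i : ContinuousAt _ x₀)
    refine h2.congr ?_
    filter_upwards [eventually_mem_baseSet E x₀] with x hx
    ext w : 1
    change a x ((E.triv x₀).symmL ℂ x (_)) = a x (b x w)
    congr 1
    rw [hb, ContinuousLinearMap.coe_coe, sum_apply, map_sum]
    refine Finset.sum_congr rfl fun i _ => ?_
    change (E.triv x₀).symmL ℂ x ((σ x)⁻¹ • f i x • (E.triv x₀).continuousLinearMapAt ℂ x
      ((E.triv (i : M)).symmL ℂ x (w i))) = _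
    rw [ContinuousLinearMap.map_smul_of_tower, ContinuousLinearMap.map_smul_of_tower,
      Trivialization.symmL_continuousLinearMapAt _ hx]

end
end SmoothComplexBundle

/-- Preimage of a ball under a linear map. Convexity lets a partition of unity average local choices
of `B` near `v`. -/
theorem convex_setOf_norm_mul_sub_lt_one {A : Type*} [NormedRing A] [NormedSpace ℝ A]
    [SMulCommClass ℝ A A] (u v : A) : Convex ℝ {B : A | ‖u * (v - B)‖ < 1} := by
  have h : {B : A | ‖u * (v - B)‖ < 1} = (fun B => u * B) ⁻¹' Metric.ball (u * v) 1 := by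
    ext B
    rw [Set.mem_preimage, mem_ball_iff_norm', ← mul_sub]
    rfl
  rw [h]
  exact (convex_ball _ _).is_linear_preimage
    ⟨fun _ _ => mul_add _ _ _, fun _ _ => mul_smul_comm _ _ _⟩

/-! ### Trivializations over contractible sets, and gluing. -/

namespace SmoothComplexBundle

section

variable {EM : Type*} [NormedAddCommGroup EM] [NormedSpace ℝ EM]
  {H : Type*} [TopologicalSpace H] {I : ModelWithCorners ℝ EM H}
  {M : Type*} [TopologicalSpace M] [ChartedSpace H M]
  {P : Type*} [NormedAddCommGroup P] [NormedSpace ℂ P]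
  {E : SmoothComplexBundle I M P}

/-- Over a closed contractible subset of a compact manifold, every smooth complex vector bundle
has a smooth trivialization. -/
theorem exists_smoothHom_injective_of_contractibleSpace [FiniteDimensional ℝ EM]
    [IsManifold I ∞ M] [T2Space M] [CompactSpace M] [FiniteDimensional ℂ P]
    (E : SmoothComplexBundle I M P) {K : Set M} (hK : IsClosed K) [ContractibleSpace K] :
    ∃ ψ : ∀ x, E.Fib x →L[ℂ] P, SmoothHom ψ ∧ ∀ x ∈ K, Function.Injective (ψ x) := by
  classical
  obtain ⟨s, a, b, ha, hba, hab⟩ := exists_summand_of_trivial E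
  have := FiniteDimensional.complete ℂ (s → P)
  have := isCompact_iff_compactSpace.1 hK.isCompact
  let A := (s → P) →L[ℂ] (s → P)
  let p : C(K, A) := ⟨fun x => (a x).comp (b x), hab.comp continuous_subtype_val⟩
  obtain ⟨c, g, g', hg, hc⟩ := ContractibleSpace.exists_unit_mul_mul_of_idempotent p
    (fun x => by ext1 w; exact congrArg (a x) (hba x (b x w)))
  -- The tolerance is chosen for the injectivity argument below; off `K` it imposes nothing.
  let T : M → Set A := fun x => {B | ∀ h : x ∈ K, ‖g' ⟨x, h⟩ * p c * (g ⟨x, h⟩ - B)‖ < 1}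
  obtain ⟨G, hG⟩ := exists_contMDiffMap_forall_mem_convex_of_local_const I (t := T) (n := ⊤)
    (fun x => by
      by_cases h : x ∈ K
      · have h1 : T x = {B | ‖g' ⟨x, h⟩ * p c * (g ⟨x, h⟩ - B)‖ < 1} := by simp [T, h]
        rw [h1]
        exact convex_setOf_norm_mul_sub_lt_one _ _
      · have h1 : T x = Set.univ := by simp [T, h]
        rw [h1]
        exact convex_univ)
    (fun x => by
      by_cases h : x ∈ K
      · refine ⟨g ⟨x, h⟩, ?_⟩
        have h1 : Continuous fun y : K => ‖g' y * p c * (g y - g ⟨x, h⟩)‖ := by fun_prop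
        have h2 : ∀ᶠ y in 𝓝 (⟨x, h⟩ : K), ‖g' y * p c * (g y - g ⟨x, h⟩)‖ < 1 :=
          h1.continuousAt.eventually_lt continuousAt_const (by simp)
        rw [nhds_subtype_eq_comap, Filter.eventually_comap] at h2
        exact h2.mono fun y hy hyK => hy ⟨y, hyK⟩ rfl
      · exact ⟨0, Filter.mem_of_superset (hK.isOpen_compl.mem_nhds h)
          fun y hy hyK => absurd hyK hy⟩)
  let e := (E.triv c).continuousLinearEquivAt ℂ c (mem_baseSet_trivializationAt P E.Fib c)
  refine ⟨fun x => ((e.toContinuousLinearMap.comp (b c)).comp (G x)).comp (a x),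
    ha.clm_comp (G := fun x => (e.toContinuousLinearMap.comp (b c)).comp (G x)) ?_,
    fun x hx => ?_⟩
  · exact ((ContinuousLinearMap.compL ℂ (s → P) (s → P) P
      (e.toContinuousLinearMap.comp (b c))).restrictScalars ℝ).contDiff.contMDiff.comp G.contMDiff
  · refine (injective_iff_map_eq_zero _).2 fun w hw => ?_
    have h1 : b c (G x (a x w)) = 0 := e.injective (hw.trans (map_zero e).symm)
    have h2 : p c (G x (a x w)) = 0 := by
      change a c (b c _) = 0
      rw [h1, map_zero]
    have h3 : p ⟨x, hx⟩ (a x w) = a x w := congrArg (a x) (hba x w)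
    have h4 := congrArg (fun L : A => L (a x w)) (hc ⟨x, hx⟩)
    have h5 := congrArg (fun L : A => L (a x w)) (hg ⟨x, hx⟩)
    simp only [mul_apply_eq_comp, h3] at h4
    -- If `w` is in the kernel, the `G` term vanishes and the `g` term gives `g' g (a x w)`; an
    -- operator of norm below `1` fixes no nonzero vector.
    have h6 : (g' ⟨x, hx⟩ * p c * (g ⟨x, hx⟩ - G x)) (a x w) = a x w := by
      simp only [mul_apply_eq_comp, sub_apply, map_sub, h4, h2, map_zero, sub_zero]
      exact h5
    have h7 : a x w = 0 := by
      by_contra hne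
      have h8 := (g' ⟨x, hx⟩ * p c * (g ⟨x, hx⟩ - G x)).le_opNorm (a x w)
      rw [h6] at h8
      nlinarith [hG x hx, norm_pos_iff.2 hne]
    rw [← hba x w, h7, map_zero]

/-- Smooth trivializations over two disjoint closed sets can be glued. -/
theorem SmoothHom.exists_injective_union [FiniteDimensional ℝ EM] [IsManifold I ∞ M] [T2Space M]
    [CompactSpace M] {ψ ψ' : ∀ x, E.Fib x →L[ℂ] P} (hψ : SmoothHom ψ) (hψ' : SmoothHom ψ')
    {S S' : Set M} (hS : IsClosed S) (hS' : IsClosed S') (hd : Disjoint S S')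
    (h : ∀ x ∈ S, Function.Injective (ψ x)) (h' : ∀ x ∈ S', Function.Injective (ψ' x)) :
    ∃ θ : ∀ x, E.Fib x →L[ℂ] P, SmoothHom θ ∧ ∀ x ∈ S ∪ S', Function.Injective (θ x) := by
  obtain ⟨f, hf, hf', -⟩ := exists_contMDiffMap_zero_one_of_isClosed I (n := ⊤) hS hS' hd
  refine ⟨fun x => (1 - f x) • ψ x + f x • ψ' x,
    (hψ.smul (contMDiff_const.sub f.contMDiff)).add (hψ'.smul f.contMDiff), ?_⟩
  rintro x (hx | hx)
  · simpa [hf hx] using h x hx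
  · simpa [hf' hx] using h' x hx

/-- A smooth complex vector bundle over a compact manifold is smoothly trivial over every closed
subset whose connected components are contractible. -/
theorem trivialOn_of_contractibleSpace [FiniteDimensional ℝ EM]
    [IsManifold I ∞ M] [T2Space M] [CompactSpace M] [FiniteDimensional ℂ P]
    (E : SmoothComplexBundle I M P) {K : Set M} (hK : IsClosed K)
    (hc : ∀ x ∈ K, ContractibleSpace (connectedComponentIn K x)) : E.TrivialOn K := by
  have hKc := isCompact_iff_compactSpace.1 hK.isCompact
  have key : ∃ S : Set K, IsClopen S ∧ Set.univ ⊆ S ∧ ∃ ψ : ∀ x, E.Fib x →L[ℂ] P,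
      SmoothHom ψ ∧ ∀ x ∈ S, Function.Injective (ψ x) := by
    refine isCompact_univ.induction_on (p := fun S₀ : Set K => ∃ S : Set K, IsClopen S ∧ S₀ ⊆ S ∧
      ∃ ψ : ∀ x, E.Fib x →L[ℂ] P, SmoothHom ψ ∧ ∀ x ∈ S, Function.Injective (ψ x)) ?_ ?_ ?_ ?_
    · exact ⟨∅, isClopen_empty, subset_rfl, 0, fun x₀ => by
        simpa using contMDiffAt_const, by simp⟩
    · rintro S₀ S₁ h ⟨S, h1, h2, h3⟩
      exact ⟨S, h1, h.trans h2, h3⟩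
    · rintro S₀ S₁ ⟨S, h1, h2, ψ, h3, h4⟩ ⟨S', h1', h2', ψ', h3', h4'⟩
      obtain ⟨θ, hθ, hθ'⟩ := h3.exists_injective_union h3'
        (hK.isClosedEmbedding_subtypeVal.isClosedMap S h1.isClosed)
        -- Removing `S` keeps the second set clopen in `K` and makes the two pieces disjoint, as
        -- gluing requires.
        (hK.isClosedEmbedding_subtypeVal.isClosedMap (S' \ S) (h1'.diff h1).isClosed)
        ((Set.disjoint_image_iff Subtype.val_injective).2 Set.disjoint_sdiff_right)
        (by rintro _ ⟨x, hx, rfl⟩; exact h4 x hx)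
        (by rintro _ ⟨x, hx, rfl⟩; exact h4' x hx.1)
      refine ⟨S ∪ S', h1.union h1', Set.union_subset_union h2 h2', θ, hθ, fun x hx => hθ' x ?_⟩
      rw [← Set.image_union, Set.union_sdiff_self]
      exact ⟨x, hx, rfl⟩
    · intro x _
      have hD : connectedComponentIn K x = Subtype.val '' connectedComponent x :=
        connectedComponentIn_eq_image x.2
      have hDc : IsClosed (connectedComponentIn K (x : M)) := by
        rw [hD]
        exact hK.isClosedEmbedding_subtypeVal.isClosedMap _ isClosed_connectedComponent
      have := hc x x.2
      obtain ⟨ψ, hψ, hψi⟩ := exists_smoothHom_injective_of_contractibleSpace E hDc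
      let U : Set K := {y | Function.Injective (ψ y)}
      have hU : ∀ y ∈ connectedComponent x, U ∈ 𝓝 y := fun y hy =>
        continuous_subtype_val.continuousAt.eventually
          (hψ.eventually_injective (hψi y (hD ▸ ⟨y, hy, rfl⟩)))
      -- In a compact Hausdorff space a component is the intersection of the clopen sets around it,
      -- so one of them already lies in `U`.
      rw [connectedComponent_eq_iInter_isClopen] at hU
      have : Nonempty {s : Set K // IsClopen s ∧ x ∈ s} := ⟨⟨_, isClopen_univ, Set.mem_univ x⟩⟩
      obtain ⟨⟨S, hS, hxS⟩, hSU⟩ := exists_subset_nhds_of_isCompact'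
        (V := fun s : {s : Set K // IsClopen s ∧ x ∈ s} => (s : Set K))
        (fun s s' => ⟨⟨s ∩ s', s.2.1.inter s'.2.1, s.2.2, s'.2.2⟩,
          Set.inter_subset_left, Set.inter_subset_right⟩)
        (fun s => s.2.1.isClosed.isCompact) (fun s => s.2.1.isClosed) hU
      exact ⟨S, mem_nhdsWithin_of_mem_nhds (hS.isOpen.mem_nhds hxS), S, hS, subset_rfl, ψ, hψ,
        fun y hy => hSU hy⟩
  obtain ⟨S, -, hS, ψ, hψ, hψ'⟩ := key
  exact hψ.trivialOn fun x hx => hψ' ⟨x, hx⟩ (hS (Set.mem_univ _))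

theorem IsoOn.refl (S : Set M) (E : SmoothComplexBundle I M P) : IsoOn S E E :=
  ⟨fun _ => LinearEquiv.refl ℂ _, contMDiffOn_id, contMDiffOn_id⟩

end
end SmoothComplexBundle

/-! ### The collar and the main theorem. -/

/-- A collar in a compact manifold is compact. -/
theorem IsCollar.isCompact {EM : Type*} [NormedAddCommGroup EM] [NormedSpace ℝ EM]
    {H : Type*} [TopologicalSpace H] {I : ModelWithCorners ℝ EM H}
    {M : Type*} [TopologicalSpace M] [ChartedSpace H M] {W C : Set M}
    (hC : IsCollar I W C) (hW : IsCompact W) : IsCompact C := by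
  obtain ⟨-, Φ, hs, rfl, -, hΦ, -⟩ := hC
  rw [← Φ.image_source_eq_target]
  refine IsCompact.image_of_continuousOn ?_ hΦ.continuousOn
  rw [hs]
  exact hW.prod isCompact_Icc

theorem mainTheorem7
    {EM : Type u} [NormedAddCommGroup EM] [NormedSpace ℝ EM] [FiniteDimensional ℝ EM]
    {H : Type v} [TopologicalSpace H] (I : ModelWithCorners ℝ EM H)
    {M : Type w} [TopologicalSpace M] [ChartedSpace H M] [IsManifold I ∞ M]
    [T2Space M] [CompactSpace M]
    {P : Type z} [NormedAddCommGroup P] [NormedSpace ℂ P] [FiniteDimensional ℂ P]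
    (W : Set M) (hW : W ⊆ I.boundary M) (hWc : IsClosed W)
    (C₀ : Set M) (hC₀ : IsCollar I W C₀)
    (hcontr : ∀ x ∈ C₀, ContractibleSpace (connectedComponentIn C₀ x))
    (E : SmoothComplexBundle.{u, v, w, z, t} I M P) :
    ∃ (E' : SmoothComplexBundle.{u, v, w, z, t} I M P) (C : Set M),
      C ⊆ C₀ ∧ IsCollar I W C ∧
      E'.TrivialOn C ∧
      SmoothComplexBundle.IsoOn C₀ᶜ E' E := by
  exact ⟨E, C₀, subset_rfl, hC₀, E.trivialOn_of_contractibleSpace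
    (hC₀.isCompact hWc.isCompact).isClosed hcontr, SmoothComplexBundle.IsoOn.refl _ E⟩
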